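/- For $M>0$ let $\mathcal F_M$ be the class of probability densities $f$ on $(0,\infty)$ with $f(\tau)\le M$ for all $\tau>0$ and $f(\tau)>1/M$ for all $\tau\in(0,1)$. For $f\in\mathcal F_M$ and $n\ge 1$ let $\theta\in\mathbb R^n$ be drawn as follows: $\tau$ has density $f$ and, given $\tau$, the coordinates $\theta_1,\dots,\theta_n$ are independent with $\theta_j\sim N(0,\tau)$ (variance $\tau$). For $\delta\in(0,1)$ put $t_n=n^{\delta/2}$. For every $M>0$ there are constants $C_1,C_2,c_2>0$, depending only on $M$, such that for every $\delta\in(0,1)$ the following holds. (a) For every $f\in\mathcal F_M$ and every $n\ge1$, $$C_1e^{-(1-\delta)\log n}\le \mathbb P(\|\theta\|_2<t_n)\le C_2e^{-(1-\delta)\log n}.$$ (b) For every $f\in\mathcal F_M$, every $n\ge1$ and every $\theta_0\in\mathbb R^n$ with $\|\theta_0\|_2>t_n$, with $a_n=\|\theta_0\|_2/t_n>1$, $$\mathbb P(\|\theta-\theta_0\|_2<t_n)\le e^{-c_2 n\log a_n}.$$ (c) For every $\eta>0$ there is a constant $c_1>0$, depending only on $M$, $\delta$ and $\eta$, such that for every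 sequence $\theta_0=\theta_0^{(n)}\in\mathbb R^n$ with $\|\theta_0\|_2=o(\sqrt n)$ the following holds for all sufficiently large $n$: for every $f\in\mathcal F_M$, if $a_n=\|\theta_0\|_2/t_n\ge 1+\eta$, then $$\mathbb P(\|\theta-\theta_0\|_2<t_n)\ge e^{-c_1 n\log a_n}.$$ -/

import Mathlib

open MeasureTheory ProbabilityTheory Filter Asymptotics

/-- The class `𝓕` with constant `M`: probability densities on `(0, ∞)` that are bounded by `M`
on `(0, ∞)` and exceed `1 / M` on `(0, 1)`. Values of `f` outside `(0, ∞)` play no role. -/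
structure IsClassF (M : ℝ) (f : ℝ → ℝ) : Prop where
  measurable : Measurable f
  nonneg : ∀ τ, 0 < τ → 0 ≤ f τ
  integral_eq_one : ∫ τ in Set.Ioi (0 : ℝ), f τ = 1
  le_bound : ∀ τ, 0 < τ → f τ ≤ M
  lower_bound : ∀ τ, 0 < τ → τ < 1 → 1 / M < f τ

/-- The law on `(0, ∞)` of the global parameter `τ` with density `f`. -/
noncomputable def tauLaw (f : ℝ → ℝ) : Measure ℝ :=
  (volume.restrict (Set.Ioi (0 : ℝ))).withDensity (fun τ => ENNReal.ofReal (f τ))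

/-- The conditional law of `θ` given `τ`: independent coordinates `θ_j ~ N(0, τ)`
(variance `τ`), as a measure on Euclidean space. -/
noncomputable def condLaw (n : ℕ) (τ : ℝ) : Measure (EuclideanSpace ℝ (Fin n)) :=
  (Measure.pi (fun _ : Fin n => gaussianReal 0 τ.toNNReal)).map (WithLp.toLp 2)

theorem condLaw_eq_map (n : ℕ) (τ : ℝ) :
    condLaw n τ = (Measure.pi (fun _ : Fin n => gaussianReal 0 1)).map
      (fun z => WithLp.toLp 2 (fun i => Real.sqrt τ * z i)) := by
  have h : gaussianReal 0 τ.toNNReal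
      = (gaussianReal 0 1).map (fun x => Real.sqrt τ * x) := by
    rw [gaussianReal_map_const_mul]
    congr 1
    · simp
    · ext
      by_cases hτ : 0 ≤ τ
      · simp [Real.sq_sqrt hτ, hτ]
      · have hτ' : τ ≤ 0 := le_of_not_ge hτ
        simp [Real.sqrt_eq_zero_of_nonpos hτ', hτ']
  have h2 : Measure.pi (fun _ : Fin n => gaussianReal 0 τ.toNNReal)
      = (Measure.pi (fun _ : Fin n => gaussianReal 0 1)).map
        (fun z i => Real.sqrt τ * z i) := by
    rw [h]
    have : IsProbabilityMeasure ((gaussianReal 0 1).map (fun x => Real.sqrt τ * x)) := by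
      rw [← h]; infer_instance
    exact (Measure.pi_map_pi (μ := fun _ : Fin n => gaussianReal 0 1)
      (f := fun _ x => Real.sqrt τ * x) (fun _ => by fun_prop)).symm
  rw [condLaw, h2, Measure.map_map (by fun_prop) (by fun_prop)]
  rfl

theorem measurable_condLaw (n : ℕ) : Measurable (condLaw n) := by
  refine Measure.measurable_of_measurable_coe _ fun s hs => ?_
  have hF : Measurable (fun p : ℝ × (Fin n → ℝ) =>
      (WithLp.toLp 2 (fun i => Real.sqrt p.1 * p.2 i) : EuclideanSpace ℝ (Fin n))) := by
    fun_prop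
  have h := measurable_measure_prodMk_left
    (ν := Measure.pi (fun _ : Fin n => gaussianReal 0 1)) (hF hs)
  convert h using 2 with τ
  rw [condLaw_eq_map, Measure.map_apply (by fun_prop) hs]
  rfl

/-- `condLaw n` as a Markov kernel from `τ` to `θ`. -/
noncomputable def condKernel (n : ℕ) : Kernel ℝ (EuclideanSpace ℝ (Fin n)) where
  toFun := condLaw n
  measurable' := measurable_condLaw n

/-- The marginal prior law of `θ ∈ ℝⁿ`: `τ ~ f`, and given `τ`, `θ_j ~ N(0, τ)` independently. -/
noncomputable def globalPrior (f : ℝ → ℝ) (n : ℕ) : Measure (EuclideanSpace ℝ (Fin n)) :=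
  (tauLaw f).bind (condKernel n)

/-- The radius `t_n = n^{δ/2}`. -/
noncomputable def tRad (δ : ℝ) (n : ℕ) : ℝ := (n : ℝ) ^ (δ / 2)

/-- The prior concentration `P(‖θ - θ₀‖₂ < t)`. -/
noncomputable def priorConc (f : ℝ → ℝ) (n : ℕ) (θ₀ : EuclideanSpace ℝ (Fin n)) (t : ℝ) : ℝ :=
  (globalPrior f n).real {θ | ‖θ - θ₀‖ < t}

/-!
Given `τ`, the Chernoff bound with the noncentral `χ²` Laplace transform, its parameter chosen so
that the exponential factors cancel, gives `P(‖θ - θ₀‖ < t | τ) ≤ (t / ‖θ₀‖) ^ n` uniformly in `τ`;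
averaging over `τ` yields (b). For `θ₀ = 0` the parameter `t⁻²` gives `e (1 + 2 τ / t²) ^ (-n / 2)`,
whose integral against a density at most `M` is of order `t² / n`; this is also a lower bound,
since Markov's inequality leaves half of the conditional mass in the ball when `τ ≤ t² / (2 n)`.
For (c), take `τ` of order `‖θ₀‖² / n` and bound the conditional mass of the ball below by that of
an inscribed cube: this gives `(t / ‖θ₀‖) ^ n e ^ (-C n)`, where `e ^ (-C n)` also pays for the
prior mass of these `τ`. Finally `e ^ (-C n) ≥ (‖θ₀‖ / t) ^ (-C n / log (1 + η))`, since
`‖θ₀‖ / t ≥ 1 + η`.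
-/

theorem measureReal_bind {α β : Type*} {_ : MeasurableSpace α} {_ : MeasurableSpace β}
    (μ : Measure α) (κ : Kernel α β) [IsFiniteKernel κ] {s : Set β} (hs : MeasurableSet s) :
    (μ.bind κ).real s = ∫ x, (κ x).real s ∂μ := by
  rw [measureReal_def, Measure.bind_apply hs κ.aemeasurable]
  exact (integral_toReal (κ.measurable_coe hs).aemeasurable
    (Eventually.of_forall fun x => measure_lt_top (κ x) s)).symm

section Mixture

variable {α β : Type*} {_ : MeasurableSpace α} {_ : MeasurableSpace β} {μ : Measure α}
  {κ : Kernel α β} {s : Set β} {b : ℝ}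

theorem integrable_kernel_measureReal [IsFiniteMeasure μ] [IsFiniteKernel κ]
    (hs : MeasurableSet s) : Integrable (fun x => (κ x).real s) μ :=
  .of_bound (κ.measurable_coe hs).ennreal_toReal.aestronglyMeasurable (κ.bound.toReal) <|
    .of_forall fun x => by
      rw [Real.norm_of_nonneg measureReal_nonneg]
      exact ENNReal.toReal_mono κ.bound_ne_top (κ.measure_le_bound x s)

theorem measureReal_bind_le [IsProbabilityMeasure μ] [IsFiniteKernel κ] (hs : MeasurableSet s)
    (hb : ∀ᵐ x ∂μ, (κ x).real s ≤ b) : (μ.bind κ).real s ≤ b := by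
  calc (μ.bind κ).real s = ∫ x, (κ x).real s ∂μ := measureReal_bind μ κ hs
    _ ≤ ∫ _, b ∂μ := integral_mono_ae (integrable_kernel_measureReal hs) (integrable_const b) hb
    _ = b := by simp

theorem mul_le_measureReal_bind [IsFiniteMeasure μ] [IsFiniteKernel κ] {A : Set α}
    (hA : MeasurableSet A) (hs : MeasurableSet s) (hb : ∀ x ∈ A, b ≤ (κ x).real s) :
    b * μ.real A ≤ (μ.bind κ).real s := by
  have hint := integrable_kernel_measureReal (μ := μ) (κ := κ) hs
  calc b * μ.real A ≤ ∫ x in A, (κ x).real s ∂μ :=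
        setIntegral_ge_of_const_le_real hA (measure_ne_top μ A) hb hint.integrableOn
    _ ≤ ∫ x, (κ x).real s ∂μ :=
        setIntegral_le_integral hint (.of_forall fun _ => measureReal_nonneg)
    _ = (μ.bind κ).real s := (measureReal_bind μ κ hs).symm

end Mixture

theorem mgf_sub_sq_gaussianReal (μ : ℝ) {v : NNReal} (m : ℝ) {s : ℝ} (hs : 2 * s * v < 1) :
    mgf (fun x => (x - m) ^ 2) (gaussianReal μ v) s
      = (√(1 - 2 * s * v))⁻¹ * Real.exp (s / (1 - 2 * s * v) * (μ - m) ^ 2) := by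
  rcases eq_or_ne v 0 with rfl | hv
  · simp [mgf, gaussianReal_zero_var]
  set w : ℝ := 1 - 2 * s * v with hw
  have hw0 : 0 < w := by linarith
  have complete_square : ∀ x : ℝ, gaussianPDFReal μ v x • Real.exp (s * (x - m) ^ 2)
      = (√(2 * Real.pi * v))⁻¹ * Real.exp (s / w * (μ - m) ^ 2)
        * Real.exp (-(w / (2 * v)) * (x - (μ - 2 * s * v * m) / w) ^ 2) := by
    intro x
    rw [gaussianPDFReal, smul_eq_mul, mul_assoc (√_)⁻¹, mul_assoc (√_)⁻¹, ← Real.exp_add,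
      ← Real.exp_add]
    congr 2
    field_simp
    rw [hw]
    ring
  have normalization : Real.pi / (w / (2 * v)) = 2 * Real.pi * v / w := by field_simp
  rw [mgf, integral_gaussianReal_eq_integral_smul hv]
  simp_rw [complete_square]
  rw [integral_const_mul,
    integral_sub_right_eq_self (fun x => Real.exp (-(w / (2 * v)) * x ^ 2)), integral_gaussian,
    normalization, Real.sqrt_div (by positivity)]
  field_simp

theorem mgf_norm_sub_sq_condLaw (n : ℕ) {τ : ℝ} (hτ : 0 ≤ τ) (θ₀ : EuclideanSpace ℝ (Fin n))
    {s : ℝ} (hs : 2 * s * τ < 1) :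
    mgf (fun θ => ‖θ - θ₀‖ ^ 2) (condLaw n τ) s
      = (1 - 2 * s * τ) ^ (-(n / 2) : ℝ) * Real.exp (s / (1 - 2 * s * τ) * ‖θ₀‖ ^ 2) := by
  have hs' : 2 * s * τ.toNNReal < 1 := by rwa [Real.coe_toNNReal _ hτ]
  have exp_eq_prod : ∀ x : Fin n → ℝ, Real.exp (s * ‖WithLp.toLp 2 x - θ₀‖ ^ 2)
      = ∏ i, Real.exp (s * (x i - θ₀ i) ^ 2) := fun x => by
    rw [EuclideanSpace.real_norm_sq_eq, Finset.mul_sum, Real.exp_sum]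
    rfl
  calc mgf (fun θ => ‖θ - θ₀‖ ^ 2) (condLaw n τ) s
      = ∏ i, mgf (fun x => (x - θ₀ i) ^ 2) (gaussianReal 0 τ.toNNReal) s := by
        rw [mgf, condLaw, integral_map (by fun_prop) (by fun_prop)]
        simp_rw [exp_eq_prod]
        exact integral_fintype_prod_eq_prod (fun i x => Real.exp (s * (x - θ₀ i) ^ 2))
    _ = ∏ i, (√(1 - 2 * s * τ))⁻¹ * Real.exp (s / (1 - 2 * s * τ) * θ₀ i ^ 2) := by
        simp only [mgf_sub_sq_gaussianReal 0 _ hs', Real.coe_toNNReal _ hτ, zero_sub, neg_sq]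
    _ = _ := by
        rw [Finset.prod_mul_distrib, Finset.prod_const, Finset.card_univ, Fintype.card_fin,
          ← Real.exp_sum, ← Finset.mul_sum, EuclideanSpace.real_norm_sq_eq, Real.sqrt_eq_rpow,
          ← Real.rpow_neg (by linarith), ← Real.rpow_mul_natCast (by linarith)]
        ring_nf

instance isProbabilityMeasure_condLaw (n : ℕ) (τ : ℝ) : IsProbabilityMeasure (condLaw n τ) :=
  Measure.isProbabilityMeasure_map (by fun_prop)

instance isMarkovKernel_condKernel (n : ℕ) : IsMarkovKernel (condKernel n) :=
  ⟨isProbabilityMeasure_condLaw n⟩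

theorem condLaw_real_ball_le_exp_mul_rpow (n : ℕ) {τ l : ℝ} (hτ : 0 ≤ τ) (hl : 0 ≤ l)
    (θ₀ : EuclideanSpace ℝ (Fin n)) (t : ℝ) :
    (condLaw n τ).real (Metric.ball θ₀ t) ≤ Real.exp (l * t ^ 2) *
      ((1 + 2 * l * τ) ^ (-(n / 2) : ℝ) * Real.exp (-(l / (1 + 2 * l * τ)) * ‖θ₀‖ ^ 2)) := by
  have hsub : Metric.ball θ₀ t ⊆ {θ | ‖θ - θ₀‖ ^ 2 ≤ t ^ 2} := fun θ hθ =>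
    pow_le_pow_left₀ (norm_nonneg _) (mem_ball_iff_norm.1 hθ).le 2
  have hint : Integrable (fun θ => Real.exp (-l * ‖θ - θ₀‖ ^ 2)) (condLaw n τ) :=
    .of_bound (by fun_prop) 1 <| .of_forall fun θ => by
      rw [Real.norm_of_nonneg (Real.exp_pos _).le, Real.exp_le_one_iff]
      exact mul_nonpos_of_nonpos_of_nonneg (neg_nonpos.2 hl) (sq_nonneg _)
  have hlτ : 2 * -l * τ < 1 := by nlinarith [mul_nonneg hl hτ]
  refine (measureReal_mono hsub).trans
    ((measure_le_le_exp_mul_mgf _ (neg_nonpos.2 hl) hint).trans_eq ?_)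
  rw [mgf_norm_sub_sq_condLaw n hτ θ₀ hlτ]
  ring_nf

theorem condLaw_real_ball_zero_le (n : ℕ) {τ t : ℝ} (hτ : 0 ≤ τ) (ht : 0 < t) :
    (condLaw n τ).real (Metric.ball 0 t)
      ≤ Real.exp 1 * (1 + 2 * (t ^ 2)⁻¹ * τ) ^ (-(n / 2) : ℝ) := by
  have h := condLaw_real_ball_le_exp_mul_rpow n hτ (inv_nonneg.2 (sq_nonneg t)) 0 t
  rwa [inv_mul_cancel₀ (pow_pos ht 2).ne', norm_zero, zero_pow two_ne_zero, mul_zero,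
    Real.exp_zero, mul_one] at h

theorem condLaw_real_ball_le_div_pow (n : ℕ) {τ t : ℝ} (hτ : 0 < τ) (ht : 0 < t)
    {θ₀ : EuclideanSpace ℝ (Fin n)} (hθ₀ : t ≤ ‖θ₀‖) :
    (condLaw n τ).real (Metric.ball θ₀ t) ≤ (t / ‖θ₀‖) ^ n := by
  have hr : 0 < ‖θ₀‖ := ht.trans_le hθ₀
  -- The Chernoff parameter for which both exponential factors cancel: `1 + 2 l τ = (‖θ₀‖ / t) ^ 2`.
  set l : ℝ := ((‖θ₀‖ / t) ^ 2 - 1) / (2 * τ) with hl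
  have hl0 : 0 ≤ l := by
    have : 1 ≤ ‖θ₀‖ / t := (one_le_div ht).2 hθ₀
    exact div_nonneg (sub_nonneg.2 (one_le_pow₀ this)) (by positivity)
  have hlτ : 1 + 2 * l * τ = (‖θ₀‖ / t) ^ 2 := by rw [hl]; field_simp; ring
  have hexp : l * t ^ 2 + -(l / (‖θ₀‖ / t) ^ 2) * ‖θ₀‖ ^ 2 = 0 := by field_simp; ring
  have hpow : ((‖θ₀‖ / t) ^ 2) ^ (-(n / 2) : ℝ) = (t / ‖θ₀‖) ^ n := by
    rw [← Real.rpow_natCast_mul (by positivity), ← inv_div, Real.inv_rpow (by positivity),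
      ← Real.rpow_neg (by positivity), ← Real.rpow_natCast]
    congr 1
    push_cast
    ring
  refine (condLaw_real_ball_le_exp_mul_rpow n hτ.le hl0 θ₀ t).trans_eq ?_
  rw [hlτ, hpow, mul_left_comm, ← Real.exp_add, hexp, Real.exp_zero, mul_one]

theorem integrable_eval_sq_pi_gaussianReal {ι : Type*} [Fintype ι] (μ : ℝ) (v : NNReal) (i : ι) :
    Integrable (fun x : ι → ℝ => x i ^ 2) (Measure.pi fun _ => gaussianReal μ v) :=
  integrable_comp_eval (μ := fun _ : ι => gaussianReal μ v) (i := i) (f := fun x : ℝ => x ^ 2)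
    (memLp_id_gaussianReal 2).integrable_sq

theorem integrable_norm_sq_condLaw (n : ℕ) (τ : ℝ) :
    Integrable (fun θ => ‖θ‖ ^ 2) (condLaw n τ) := by
  rw [condLaw, integrable_map_measure (by fun_prop) (by fun_prop)]
  simp only [Function.comp_def, EuclideanSpace.real_norm_sq_eq]
  exact integrable_finsetSum _ fun i _ => integrable_eval_sq_pi_gaussianReal 0 _ i

theorem integral_sq_gaussianReal_zero (v : NNReal) : ∫ x, x ^ 2 ∂gaussianReal 0 v = v := by
  rw [← variance_fun_id_gaussianReal (μ := 0), variance_of_integral_eq_zero (by fun_prop) (by simp)]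

theorem integral_norm_sq_condLaw (n : ℕ) {τ : ℝ} (hτ : 0 ≤ τ) :
    ∫ θ, ‖θ‖ ^ 2 ∂condLaw n τ = n * τ := by
  calc ∫ θ, ‖θ‖ ^ 2 ∂condLaw n τ
      = ∑ i : Fin n, ∫ x : Fin n → ℝ, x i ^ 2 ∂Measure.pi fun _ => gaussianReal 0 τ.toNNReal := by
        rw [condLaw, integral_map (by fun_prop) (by fun_prop)]
        simp only [EuclideanSpace.real_norm_sq_eq]
        exact integral_finsetSum _ fun i _ => integrable_eval_sq_pi_gaussianReal 0 _ i
    _ = ∑ _i : Fin n, ∫ x, x ^ 2 ∂gaussianReal 0 τ.toNNReal :=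
        Finset.sum_congr rfl fun i _ => integral_comp_eval
          (μ := fun _ : Fin n => gaussianReal 0 τ.toNNReal) (f := fun x : ℝ => x ^ 2) (by fun_prop)
    _ = n * τ := by simp [integral_sq_gaussianReal_zero, hτ]

theorem one_sub_le_condLaw_real_ball (n : ℕ) {τ t : ℝ} (hτ : 0 ≤ τ) (ht : 0 < t) :
    1 - n * τ / t ^ 2 ≤ (condLaw n τ).real (Metric.ball 0 t) := by
  have hcompl : (Metric.ball (0 : EuclideanSpace ℝ (Fin n)) t)ᶜ = {θ | t ^ 2 ≤ ‖θ‖ ^ 2} := by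
    ext θ
    simp [pow_le_pow_iff_left₀ ht.le (norm_nonneg θ) two_ne_zero]
  have markov : t ^ 2 * (condLaw n τ).real (Metric.ball 0 t)ᶜ ≤ n * τ := by
    rw [hcompl, ← integral_norm_sq_condLaw n hτ]
    exact mul_meas_ge_le_integral_of_nonneg (.of_forall fun θ => sq_nonneg ‖θ‖)
      (integrable_norm_sq_condLaw n τ) (t ^ 2)
  rw [probReal_compl_eq_one_sub Metric.isOpen_ball.measurableSet] at markov
  have := (le_div_iff₀' (pow_pos ht 2)).2 markov
  linarith

theorem le_gaussianReal_real_Ioo (μ : ℝ) {v : NNReal} (hv : v ≠ 0) (m : ℝ) {h : ℝ} (hh : 0 ≤ h) :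
    2 * h * ((√(2 * Real.pi * v))⁻¹ * Real.exp (-((m - μ) ^ 2 + h ^ 2) / v))
      ≤ (gaussianReal μ v).real (Set.Ioo (m - h) (m + h)) := by
  have density_ge : ∀ x ∈ Set.Ioo (m - h) (m + h),
      (√(2 * Real.pi * v))⁻¹ * Real.exp (-((m - μ) ^ 2 + h ^ 2) / v) ≤ gaussianPDFReal μ v x := by
    intro x hx
    have hxm : (x - m) ^ 2 ≤ h ^ 2 := sq_le_sq' (by linarith [hx.1]) (by linarith [hx.2])
    have hxμ : (x - μ) ^ 2 ≤ 2 * ((m - μ) ^ 2 + h ^ 2) := by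
      nlinarith [sq_nonneg ((x - m) - (m - μ))]
    rw [gaussianPDFReal, mul_comm (2 : ℝ) (v : ℝ), ← div_div, div_right_comm]
    gcongr
    linarith
  rw [measureReal_def, gaussianReal_apply_eq_integral _ hv, ENNReal.toReal_ofReal
    (setIntegral_nonneg measurableSet_Ioo fun x _ => gaussianPDFReal_nonneg _ _ x)]
  calc 2 * h * ((√(2 * Real.pi * v))⁻¹ * Real.exp (-((m - μ) ^ 2 + h ^ 2) / v))
      = (√(2 * Real.pi * v))⁻¹ * Real.exp (-((m - μ) ^ 2 + h ^ 2) / v)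
          * volume.real (Set.Ioo (m - h) (m + h)) := by
        rw [Real.volume_real_Ioo_of_le (by linarith)]
        ring
    _ ≤ ∫ x in Set.Ioo (m - h) (m + h), gaussianPDFReal μ v x :=
        setIntegral_ge_of_const_le_real measurableSet_Ioo (by simp) density_ge
          (integrable_gaussianPDFReal μ v).integrableOn

theorem pi_Ioo_subset_preimage_ball {n : ℕ} (hn : 0 < n) {t : ℝ} (ht : 0 < t)
    (θ₀ : EuclideanSpace ℝ (Fin n)) :
    (Set.univ.pi fun i => Set.Ioo (θ₀ i - t / √n) (θ₀ i + t / √n))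
      ⊆ WithLp.toLp 2 ⁻¹' Metric.ball θ₀ t := by
  intro x hx
  have : Nonempty (Fin n) := ⟨⟨0, hn⟩⟩
  have hn0 : (0 : ℝ) < n := by exact_mod_cast hn
  have coord_sq_lt : ∀ i, (x i - θ₀ i) ^ 2 < t ^ 2 / n := fun i => by
    have hxi := hx i trivial
    rw [← Real.sq_sqrt hn0.le, ← div_pow]
    exact sq_lt_sq' (by linarith [hxi.1]) (by linarith [hxi.2])
  rw [Set.mem_preimage, mem_ball_iff_norm]
  refine lt_of_pow_lt_pow_left₀ 2 ht.le ?_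
  calc ‖WithLp.toLp 2 x - θ₀‖ ^ 2 = ∑ i, (x i - θ₀ i) ^ 2 := EuclideanSpace.real_norm_sq_eq _
    _ < ∑ _i : Fin n, t ^ 2 / n :=
        Finset.sum_lt_sum_of_nonempty Finset.univ_nonempty fun i _ => coord_sq_lt i
    _ = t ^ 2 := by
        rw [Finset.sum_const, Finset.card_univ, Fintype.card_fin, nsmul_eq_mul]
        field_simp

theorem le_condLaw_real_ball {n : ℕ} (hn : 0 < n) {τ t : ℝ} (hτ : 0 < τ) (ht : 0 < t)
    (θ₀ : EuclideanSpace ℝ (Fin n)) :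
    (2 * t / √(2 * Real.pi * (n * τ))) ^ n * Real.exp (-(‖θ₀‖ ^ 2 + t ^ 2) / τ)
      ≤ (condLaw n τ).real (Metric.ball θ₀ t) := by
  have hn0 : (0 : ℝ) < n := by exact_mod_cast hn
  set h : ℝ := t / √n with hh
  have hv : τ.toNNReal ≠ 0 := (Real.toNNReal_pos.2 hτ).ne'
  have hscale : 2 * t / √(2 * Real.pi * (n * τ)) = 2 * h * (√(2 * Real.pi * τ))⁻¹ := by
    rw [hh, mul_left_comm, Real.sqrt_mul hn0.le]
    field_simp
  have hexponent : ∑ i, -(θ₀ i ^ 2 + h ^ 2) / τ = -(‖θ₀‖ ^ 2 + t ^ 2) / τ := by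
    rw [← Finset.sum_div, Finset.sum_neg_distrib, Finset.sum_add_distrib, Finset.sum_const,
      Finset.card_univ, Fintype.card_fin, nsmul_eq_mul, EuclideanSpace.real_norm_sq_eq, hh,
      div_pow, Real.sq_sqrt hn0.le, mul_div_cancel₀ _ hn0.ne']
  calc (2 * t / √(2 * Real.pi * (n * τ))) ^ n * Real.exp (-(‖θ₀‖ ^ 2 + t ^ 2) / τ)
      = ∏ i, 2 * h * ((√(2 * Real.pi * τ))⁻¹ * Real.exp (-(θ₀ i ^ 2 + h ^ 2) / τ)) := by
        simp_rw [← mul_assoc (2 * h)]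
        rw [Finset.prod_mul_distrib, Finset.prod_const, Finset.card_univ, Fintype.card_fin,
          ← Real.exp_sum, hexponent, hscale]
    _ ≤ ∏ i, (gaussianReal 0 τ.toNNReal).real (Set.Ioo (θ₀ i - h) (θ₀ i + h)) :=
        Finset.prod_le_prod (fun i _ => by positivity) fun i _ => by
          simpa only [Real.coe_toNNReal _ hτ.le, sub_zero]
            using le_gaussianReal_real_Ioo 0 hv (θ₀ i) (h := h) (by positivity)
    _ = (Measure.pi fun _ => gaussianReal 0 τ.toNNReal).real
          (Set.univ.pi fun i => Set.Ioo (θ₀ i - h) (θ₀ i + h)) := by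
        rw [measureReal_def, Measure.pi_pi, ENNReal.toReal_prod]
        rfl
    _ ≤ (condLaw n τ).real (Metric.ball θ₀ t) := by
        rw [condLaw, map_measureReal_apply (by fun_prop) Metric.isOpen_ball.measurableSet]
        exact measureReal_mono (pi_Ioo_subset_preimage_ball hn ht θ₀)

theorem integrableOn_one_add_mul_rpow_Ioi {c p : ℝ} (hc : 0 < c) (hp : p < -1) :
    IntegrableOn (fun x => (1 + c * x) ^ p) (Set.Ioi 0) := by
  simp only [add_comm (1 : ℝ)]
  rw [integrableOn_Ioi_comp_mul_left_iff (fun x => (x + 1) ^ p) 0 hc, mul_zero]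
  exact integrableOn_add_rpow_Ioi_of_lt hp (by norm_num)

theorem integral_one_add_mul_rpow_Ioi {c p : ℝ} (hc : 0 < c) (hp : p < -1) :
    ∫ x in Set.Ioi 0, (1 + c * x) ^ p = -(c * (p + 1))⁻¹ := by
  have hshift : ∫ x in Set.Ioi (0 : ℝ), (x + 1) ^ p = ∫ x in Set.Ioi (1 : ℝ), x ^ p := by
    simpa using (measurePreserving_add_right volume (1 : ℝ)).setIntegral_preimage_emb
      (measurableEmbedding_addRight 1) (fun x => x ^ p) (Set.Ioi 1)
  simp only [add_comm (1 : ℝ)]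
  rw [integral_comp_mul_left_Ioi (fun x => (x + 1) ^ p) 0 hc, mul_zero, hshift,
    integral_Ioi_rpow_of_lt hp one_pos, Real.one_rpow, smul_eq_mul, mul_inv]
  ring

theorem exp_le_condLaw_real_ball {n : ℕ} (hn : 0 < n) {τ t L : ℝ} (hτ : 0 < τ) (ht : 0 < t)
    {θ₀ : EuclideanSpace ℝ (Fin n)} (hθ₀ : t ≤ ‖θ₀‖) (hlow : n * τ ≤ ‖θ₀‖ ^ 2)
    (hupp : ‖θ₀‖ ^ 2 ≤ L * (n * τ)) :
    Real.exp (-(n * (Real.log (‖θ₀‖ / t) + 1 + 2 * L)))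
      ≤ (condLaw n τ).real (Metric.ball θ₀ t) := by
  have hn0 : (0 : ℝ) < n := by exact_mod_cast hn
  have hr : 0 < ‖θ₀‖ := ht.trans_le hθ₀
  have hsqrt : √(2 * Real.pi * (n * τ)) ≤ 4 * ‖θ₀‖ := by
    rw [Real.sqrt_le_left (by positivity)]
    nlinarith [Real.pi_pos, Real.pi_lt_four]
  have hbase : Real.exp (-(Real.log (‖θ₀‖ / t) + 1)) ≤ 2 * t / √(2 * Real.pi * (n * τ)) :=
    calc Real.exp (-(Real.log (‖θ₀‖ / t) + 1)) = t / ‖θ₀‖ / Real.exp 1 := by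
          rw [neg_add, Real.exp_add, Real.exp_neg, Real.exp_log (by positivity), inv_div,
            Real.exp_neg, div_eq_mul_inv _ (Real.exp 1)]
      _ ≤ t / ‖θ₀‖ / 2 := by
          gcongr
          linarith [Real.add_one_le_exp (1 : ℝ)]
      _ = 2 * t / (4 * ‖θ₀‖) := by field_simp; norm_num
      _ ≤ 2 * t / √(2 * Real.pi * (n * τ)) := by gcongr
  have hexponent : -(n * (2 * L)) ≤ -(‖θ₀‖ ^ 2 + t ^ 2) / τ := by
    have : t ^ 2 ≤ ‖θ₀‖ ^ 2 := pow_le_pow_left₀ ht.le hθ₀ 2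
    rw [le_div_iff₀ hτ]
    linarith
  calc Real.exp (-(n * (Real.log (‖θ₀‖ / t) + 1 + 2 * L)))
      = Real.exp (-(Real.log (‖θ₀‖ / t) + 1)) ^ n * Real.exp (-(n * (2 * L))) := by
        rw [← Real.exp_nat_mul, ← Real.exp_add]
        ring_nf
    _ ≤ (2 * t / √(2 * Real.pi * (n * τ))) ^ n * Real.exp (-(‖θ₀‖ ^ 2 + t ^ 2) / τ) := by
        gcongr
    _ ≤ (condLaw n τ).real (Metric.ball θ₀ t) := le_condLaw_real_ball hn hτ ht θ₀

theorem ae_tauLaw_pos (f : ℝ → ℝ) : ∀ᵐ τ ∂tauLaw f, 0 < τ :=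
  (withDensity_absolutelyContinuous _ _).ae_le (ae_restrict_mem measurableSet_Ioi)

theorem priorConc_eq_measureReal_bind_ball (f : ℝ → ℝ) (n : ℕ) (θ₀ : EuclideanSpace ℝ (Fin n))
    (t : ℝ) : priorConc f n θ₀ t = ((tauLaw f).bind (condKernel n)).real (Metric.ball θ₀ t) := by
  rw [ball_eq, priorConc, globalPrior]

theorem priorConc_zero (f : ℝ → ℝ) (n : ℕ) (t : ℝ) :
    priorConc f n 0 t = (globalPrior f n).real {θ | ‖θ‖ < t} := by
  simp only [priorConc, sub_zero]

namespace IsClassF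

variable {M : ℝ} {f : ℝ → ℝ}

theorem bound_pos (hf : IsClassF M f) : 0 < M := by
  have hM : 0 ≤ M := (hf.nonneg 1 one_pos).trans (hf.le_bound 1 one_pos)
  refine hM.lt_of_ne' fun h => ?_
  have := (hf.lower_bound (1 / 2) (by norm_num) (by norm_num)).trans_le
    (hf.le_bound (1 / 2) (by norm_num))
  simp [h] at this

theorem isProbabilityMeasure_tauLaw (hf : IsClassF M f) : IsProbabilityMeasure (tauLaw f) := by
  have hint : Integrable f (volume.restrict (Set.Ioi 0)) :=
    .of_integral_ne_zero (by rw [hf.integral_eq_one]; exact one_ne_zero)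
  constructor
  rw [tauLaw, withDensity_apply _ .univ, Measure.restrict_univ,
    ← ofReal_integral_eq_lintegral_ofReal hint, hf.integral_eq_one, ENNReal.ofReal_one]
  exact (ae_restrict_iff' measurableSet_Ioi).2 (.of_forall hf.nonneg)

theorem tauLaw_le (hf : IsClassF M f) :
    tauLaw f ≤ ENNReal.ofReal M • volume.restrict (Set.Ioi 0) := by
  rw [tauLaw, ← withDensity_const]
  refine withDensity_mono ((ae_restrict_iff' measurableSet_Ioi).2 (.of_forall fun τ hτ => ?_))
  exact ENNReal.ofReal_le_ofReal (hf.le_bound τ hτ)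

theorem le_tauLaw_real_Ioo (hf : IsClassF M f) {u v : ℝ} (hu : 0 ≤ u) (hv : v ≤ 1) :
    (v - u) / M ≤ (tauLaw f).real (Set.Ioo u v) := by
  have := hf.isProbabilityMeasure_tauLaw
  have hsub : Set.Ioo u v ⊆ Set.Ioi 0 := fun τ hτ => hu.trans_lt hτ.1
  rw [measureReal_def, ← ENNReal.ofReal_le_iff_le_toReal (measure_ne_top _ _)]
  calc ENNReal.ofReal ((v - u) / M) = ∫⁻ _ in Set.Ioo u v, ENNReal.ofReal (1 / M) := by
        rw [setLIntegral_const, Real.volume_Ioo,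
          ← ENNReal.ofReal_mul (one_div_nonneg.2 hf.bound_pos.le), one_div_mul_eq_div]
    _ ≤ ∫⁻ τ in Set.Ioo u v, ENNReal.ofReal (f τ) :=
        setLIntegral_mono hf.measurable.ennreal_ofReal fun τ hτ =>
          ENNReal.ofReal_le_ofReal (hf.lower_bound τ (hsub hτ) (hτ.2.trans_le hv)).le
    _ = tauLaw f (Set.Ioo u v) := by
        rw [tauLaw, withDensity_apply _ measurableSet_Ioo,
          Measure.restrict_restrict measurableSet_Ioo, Set.inter_eq_self_of_subset_left hsub]

theorem le_priorConc_of_le_condLaw (hf : IsClassF M f) {n : ℕ} {θ₀ : EuclideanSpace ℝ (Fin n)}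
    {t b u v : ℝ} (hb : 0 ≤ b) (hu : 0 ≤ u) (hv : v ≤ 1)
    (hball : ∀ τ ∈ Set.Ioo u v, b ≤ (condLaw n τ).real (Metric.ball θ₀ t)) :
    b * ((v - u) / M) ≤ priorConc f n θ₀ t := by
  have := hf.isProbabilityMeasure_tauLaw
  rw [priorConc_eq_measureReal_bind_ball]
  exact (mul_le_mul_of_nonneg_left (hf.le_tauLaw_real_Ioo hu hv) hb).trans
    (mul_le_measureReal_bind measurableSet_Ioo Metric.isOpen_ball.measurableSet hball)

theorem priorConc_le_one (hf : IsClassF M f) {n : ℕ} (θ₀ : EuclideanSpace ℝ (Fin n)) (t : ℝ) :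
    priorConc f n θ₀ t ≤ 1 := by
  have := hf.isProbabilityMeasure_tauLaw
  rw [priorConc_eq_measureReal_bind_ball]
  exact measureReal_bind_le Metric.isOpen_ball.measurableSet
    (.of_forall fun τ => measureReal_le_one)

theorem le_priorConc_zero (hf : IsClassF M f) {n : ℕ} {t : ℝ} (ht : 0 < t) (htn : t ^ 2 ≤ n) :
    1 / (4 * M) * (t ^ 2 / n) ≤ priorConc f n 0 t := by
  have hn : (0 : ℝ) < n := (pow_pos ht 2).trans_le htn
  have hball : ∀ τ ∈ Set.Ioo 0 (t ^ 2 / n / 2),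
      1 / 2 ≤ (condLaw n τ).real (Metric.ball 0 t) := fun τ hτ => by
    refine le_trans ?_ (one_sub_le_condLaw_real_ball n hτ.1.le ht)
    have : n * τ / t ^ 2 ≤ 1 / 2 := by
      rw [div_le_iff₀ (by positivity)]
      linarith [(lt_div_iff₀' hn).1 ((lt_div_iff₀ two_pos).1 hτ.2)]
    linarith
  have hv : t ^ 2 / n / 2 ≤ 1 := by linarith [(div_le_one hn).2 htn]
  refine le_trans (le_of_eq ?_)
    (hf.le_priorConc_of_le_condLaw one_half_pos.le le_rfl hv hball)
  ring

theorem priorConc_zero_le_div_sub_two (hf : IsClassF M f) {n : ℕ} (hn : 2 < n) {t : ℝ}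
    (ht : 0 < t) : priorConc f n 0 t ≤ M * Real.exp 1 * (t ^ 2 / (n - 2)) := by
  have := hf.isProbabilityMeasure_tauLaw
  have hn2 : (2 : ℝ) < n := by exact_mod_cast hn
  have hc : 0 < 2 * (t ^ 2)⁻¹ := by positivity
  have hp : (-(n / 2) : ℝ) < -1 := by linarith
  have hcp : 2 * (t ^ 2)⁻¹ * (-(n / 2) + 1) = -((n - 2) / t ^ 2) := by field_simp; ring
  set g : ℝ → ℝ := fun τ => (1 + 2 * (t ^ 2)⁻¹ * τ) ^ (-(n / 2) : ℝ)
  have hg : Integrable g (ENNReal.ofReal M • volume.restrict (Set.Ioi 0)) :=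
    (integrableOn_one_add_mul_rpow_Ioi hc hp).smul_measure ENNReal.ofReal_ne_top
  have hg0 : 0 ≤ᵐ[ENNReal.ofReal M • volume.restrict (Set.Ioi 0)] g :=
    Measure.ae_smul_measure ((ae_restrict_iff' measurableSet_Ioi).2 (.of_forall fun τ hτ => by
      have : 0 < τ := hτ
      positivity)) _
  rw [priorConc_eq_measureReal_bind_ball, measureReal_bind _ _ Metric.isOpen_ball.measurableSet]
  calc ∫ τ, (condKernel n τ).real (Metric.ball 0 t) ∂tauLaw f
      ≤ ∫ τ, Real.exp 1 * g τ ∂tauLaw f :=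
        integral_mono_ae (integrable_kernel_measureReal Metric.isOpen_ball.measurableSet)
          ((hg.mono_measure hf.tauLaw_le).const_mul _) <|
          (ae_tauLaw_pos f).mono fun τ hτ => condLaw_real_ball_zero_le n hτ.le ht
    _ ≤ Real.exp 1 * ∫ τ, g τ ∂ENNReal.ofReal M • volume.restrict (Set.Ioi 0) := by
        rw [integral_const_mul]
        exact mul_le_mul_of_nonneg_left (integral_mono_measure hf.tauLaw_le hg0 hg)
          (Real.exp_pos 1).le
    _ = Real.exp 1 * (M * (t ^ 2 / (n - 2))) := by
        rw [integral_smul_measure, integral_one_add_mul_rpow_Ioi hc hp,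
          ENNReal.toReal_ofReal hf.bound_pos.le, smul_eq_mul, hcp, inv_neg, neg_neg, inv_div]
    _ = M * Real.exp 1 * (t ^ 2 / (n - 2)) := by ring

theorem priorConc_zero_le (hf : IsClassF M f) {n : ℕ} (hn : 0 < n) {t : ℝ} (ht : 1 ≤ t) :
    priorConc f n 0 t ≤ (2 + 3 * M * Real.exp 1) * (t ^ 2 / n) := by
  have hn0 : (0 : ℝ) < n := by exact_mod_cast hn
  have hM := hf.bound_pos
  rcases le_or_gt n 2 with h2 | h2
  · have hn2 : (n : ℝ) ≤ 2 := by exact_mod_cast h2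
    calc priorConc f n 0 t ≤ 1 := hf.priorConc_le_one 0 t
      _ ≤ 2 * (t ^ 2 / n) := by
          rw [mul_div_assoc', one_le_div hn0]
          linarith [one_le_pow₀ ht (n := 2)]
      _ ≤ (2 + 3 * M * Real.exp 1) * (t ^ 2 / n) := by
          gcongr
          exact le_add_of_nonneg_right (by positivity)
  · have hn3 : (3 : ℝ) ≤ n := by exact_mod_cast h2
    calc priorConc f n 0 t ≤ M * Real.exp 1 * (t ^ 2 / (n - 2)) :=
          hf.priorConc_zero_le_div_sub_two h2 (one_pos.trans_le ht)
      _ ≤ M * Real.exp 1 * (t ^ 2 / (n / 3)) := by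
          gcongr
          linarith
      _ = 3 * M * Real.exp 1 * (t ^ 2 / n) := by field_simp
      _ ≤ (2 + 3 * M * Real.exp 1) * (t ^ 2 / n) := by
          gcongr
          linarith

theorem priorConc_le (hf : IsClassF M f) {n : ℕ} {t : ℝ} (ht : 0 < t)
    {θ₀ : EuclideanSpace ℝ (Fin n)} (hθ₀ : t ≤ ‖θ₀‖) :
    priorConc f n θ₀ t ≤ Real.exp (-(n * Real.log (‖θ₀‖ / t))) := by
  have := hf.isProbabilityMeasure_tauLaw
  have hexp : Real.exp (-(n * Real.log (‖θ₀‖ / t))) = (t / ‖θ₀‖) ^ n := by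
    rw [← mul_neg, Real.exp_nat_mul, Real.exp_neg, Real.exp_log (div_pos (ht.trans_le hθ₀) ht),
      inv_div]
  rw [priorConc_eq_measureReal_bind_ball, hexp]
  exact measureReal_bind_le Metric.isOpen_ball.measurableSet <|
    (ae_tauLaw_pos f).mono fun τ hτ => condLaw_real_ball_le_div_pow n hτ ht hθ₀

theorem exp_le_priorConc (hf : IsClassF M f) {n : ℕ} {t K : ℝ} (ht : 1 ≤ t) (hK : 1 ≤ K)
    {θ₀ : EuclideanSpace ℝ (Fin n)} (hθ₀ : t ≤ ‖θ₀‖) (hθ₀n : ‖θ₀‖ ^ 2 ≤ K * n) :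
    Real.exp (-(n * (Real.log (‖θ₀‖ / t) + (1 + 4 * K + 2 * K * M)))) ≤ priorConc f n θ₀ t := by
  have hM := hf.bound_pos
  have hK0 : 0 < K := one_pos.trans_le hK
  have hr : 1 ≤ ‖θ₀‖ ^ 2 := one_le_pow₀ (ht.trans hθ₀)
  have hKn : 0 < K * n := by linarith
  have hn0 : (0 : ℝ) < n := pos_of_mul_pos_right hKn hK0.le
  set v : ℝ := ‖θ₀‖ ^ 2 / (K * n) with hv
  have hv0 : 0 < v := by positivity
  have hrv : ‖θ₀‖ ^ 2 = K * (n * v) := by rw [hv]; field_simp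
  have hball : ∀ τ ∈ Set.Ioo (v / 2) v,
      Real.exp (-(n * (Real.log (‖θ₀‖ / t) + 1 + 2 * (2 * K))))
        ≤ (condLaw n τ).real (Metric.ball θ₀ t) := fun τ hτ => by
    have hτ0 : 0 < τ := (half_pos hv0).trans hτ.1
    refine exp_le_condLaw_real_ball (by exact_mod_cast hn0) hτ0 (one_pos.trans_le ht) hθ₀ ?_ ?_
    · calc n * τ ≤ n * v := by gcongr; exact hτ.2.le
        _ ≤ K * (n * v) := le_mul_of_one_le_left (by positivity) hK
        _ = ‖θ₀‖ ^ 2 := hrv.symm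
    · calc ‖θ₀‖ ^ 2 = 2 * K * (n * (v / 2)) := by rw [hrv]; ring
        _ ≤ 2 * K * (n * τ) := by gcongr; exact hτ.1.le
  have hmass : Real.exp (-(n * (2 * K * M))) ≤ (v - v / 2) / M :=
    calc Real.exp (-(n * (2 * K * M))) ≤ (n * (2 * K * M))⁻¹ := by
          rw [Real.exp_neg]
          gcongr
          linarith [Real.add_one_le_exp (n * (2 * K * M))]
      _ ≤ ‖θ₀‖ ^ 2 * (n * (2 * K * M))⁻¹ := le_mul_of_one_le_left (by positivity) hr
      _ = (v - v / 2) / M := by rw [hv]; field_simp; ring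
  calc Real.exp (-(n * (Real.log (‖θ₀‖ / t) + (1 + 4 * K + 2 * K * M))))
      = Real.exp (-(n * (Real.log (‖θ₀‖ / t) + 1 + 2 * (2 * K))))
          * Real.exp (-(n * (2 * K * M))) := by
        rw [← Real.exp_add]
        ring_nf
    _ ≤ Real.exp (-(n * (Real.log (‖θ₀‖ / t) + 1 + 2 * (2 * K)))) * ((v - v / 2) / M) := by
        gcongr
    _ ≤ priorConc f n θ₀ t :=
        hf.le_priorConc_of_le_condLaw (Real.exp_pos _).le (half_pos hv0).le
          ((div_le_one hKn).2 hθ₀n) hball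

theorem exp_neg_mul_log_le_priorConc (hf : IsClassF M f) {n : ℕ} {t K η : ℝ} (ht : 1 ≤ t)
    (hK : 1 ≤ K) (hη : 0 < η) {θ₀ : EuclideanSpace ℝ (Fin n)} (hθ₀ : (1 + η) * t ≤ ‖θ₀‖)
    (hθ₀n : ‖θ₀‖ ^ 2 ≤ K * n) :
    Real.exp (-(1 + (1 + 4 * K + 2 * K * M) / Real.log (1 + η)) * n * Real.log (‖θ₀‖ / t))
      ≤ priorConc f n θ₀ t := by
  have hM := hf.bound_pos
  have ht0 : 0 < t := one_pos.trans_le ht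
  have hlog_pos : 0 < Real.log (1 + η) := Real.log_pos (by linarith)
  have hlog_le : Real.log (1 + η) ≤ Real.log (‖θ₀‖ / t) :=
    Real.log_le_log (by positivity) ((le_div_iff₀ ht0).2 hθ₀)
  have absorb : Real.log (‖θ₀‖ / t) + (1 + 4 * K + 2 * K * M)
      ≤ (1 + (1 + 4 * K + 2 * K * M) / Real.log (1 + η)) * Real.log (‖θ₀‖ / t) := by
    rw [add_mul, one_mul, div_mul_eq_mul_div, add_le_add_iff_left, le_div_iff₀ hlog_pos]
    gcongr
  refine le_trans ?_ (hf.exp_le_priorConc ht hK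
    ((le_mul_of_one_le_left ht0.le (by linarith)).trans hθ₀) hθ₀n)
  rw [Real.exp_le_exp, neg_mul, neg_mul, neg_le_neg_iff, mul_comm _ (n : ℝ),
    mul_assoc (n : ℝ)]
  exact mul_le_mul_of_nonneg_left absorb n.cast_nonneg

end IsClassF

section Radius

variable {δ : ℝ} {n : ℕ}

theorem tRad_pos (hn : 1 ≤ n) : 0 < tRad δ n :=
  Real.rpow_pos_of_pos (by exact_mod_cast hn) _

theorem one_le_tRad (hδ : 0 ≤ δ) (hn : 1 ≤ n) : 1 ≤ tRad δ n :=
  Real.one_le_rpow (by exact_mod_cast hn) (by linarith)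

theorem tRad_sq_div (δ : ℝ) (hn : 1 ≤ n) :
    tRad δ n ^ 2 / n = Real.exp (-(1 - δ) * Real.log n) := by
  have hn0 : (0 : ℝ) < n := by exact_mod_cast hn
  rw [tRad, ← Real.rpow_mul_natCast hn0.le, Nat.cast_ofNat, div_mul_cancel₀ δ two_ne_zero,
    ← Real.rpow_sub_one hn0.ne', Real.rpow_def_of_pos hn0]
  ring_nf

theorem tRad_sq_le (hδ : δ ≤ 1) (hn : 1 ≤ n) : tRad δ n ^ 2 ≤ n := by
  have hlog : 0 ≤ Real.log n := Real.log_natCast_nonneg n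
  rw [← div_le_one (by exact_mod_cast hn), tRad_sq_div δ hn, Real.exp_le_one_iff]
  nlinarith

end Radius

theorem eventually_norm_sq_le_of_isLittleO_sqrt {E : ℕ → Type*} [∀ n, NormedAddCommGroup (E n)]
    {x : (n : ℕ) → E n} (hx : (fun n => ‖x n‖) =o[atTop] fun n : ℕ => √n) :
    ∀ᶠ n : ℕ in atTop, ‖x n‖ ^ 2 ≤ n := by
  filter_upwards [hx.bound one_pos] with n hn
  rw [one_mul, norm_norm, Real.norm_of_nonneg (Real.sqrt_nonneg _)] at hn
  exact (Real.le_sqrt (norm_nonneg _) n.cast_nonneg).1 hn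

theorem mainTheorem1_general {M : ℝ} (hM : 0 < M) :
    ∃ C₁ C₂ c₂ : ℝ, 0 < C₁ ∧ 0 < C₂ ∧ 0 < c₂ ∧
      (∀ f : ℝ → ℝ, IsClassF M f → ∀ (n : ℕ) (t : ℝ), 1 ≤ t → t ^ 2 ≤ n →
        C₁ * (t ^ 2 / n) ≤ priorConc f n 0 t ∧ priorConc f n 0 t ≤ C₂ * (t ^ 2 / n)) ∧
      (∀ f : ℝ → ℝ, IsClassF M f → ∀ (n : ℕ) (t : ℝ), 0 < t →
        ∀ θ₀ : EuclideanSpace ℝ (Fin n), t < ‖θ₀‖ →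
          priorConc f n θ₀ t ≤ Real.exp (-c₂ * n * Real.log (‖θ₀‖ / t))) ∧
      ∀ η : ℝ, 0 < η → ∀ K : ℝ, ∃ c₁ : ℝ, 0 < c₁ ∧
        ∀ f : ℝ → ℝ, IsClassF M f → ∀ (n : ℕ) (t : ℝ), 1 ≤ t →
          ∀ θ₀ : EuclideanSpace ℝ (Fin n), ‖θ₀‖ ^ 2 ≤ K * n → (1 + η) * t ≤ ‖θ₀‖ →
            Real.exp (-c₁ * n * Real.log (‖θ₀‖ / t)) ≤ priorConc f n θ₀ t := by
  refine ⟨1 / (4 * M), 2 + 3 * M * Real.exp 1, 1, by positivity, by positivity, one_pos,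
    fun f hf n t ht htn => ?_, fun f hf n t ht θ₀ hθ₀ => ?_, fun η hη K => ?_⟩
  · have ht0 : 0 < t := one_pos.trans_le ht
    have hn : 0 < n := by exact_mod_cast (pow_pos ht0 2).trans_le htn
    exact ⟨hf.le_priorConc_zero ht0 htn, hf.priorConc_zero_le hn ht⟩
  · simpa only [neg_mul, one_mul] using hf.priorConc_le ht hθ₀.le
  · have hlog : 0 < Real.log (1 + η) := Real.log_pos (by linarith)
    refine ⟨1 + (1 + 4 * max K 1 + 2 * max K 1 * M) / Real.log (1 + η), by positivity,
      fun f hf n t ht θ₀ hθ₀n hθ₀ => ?_⟩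
    exact hf.exp_neg_mul_log_le_priorConc ht (le_max_right K 1) hη hθ₀
      (hθ₀n.trans (by gcongr; exact le_max_left K 1))

theorem mainTheorem1 (M : ℝ) (hM : 0 < M) :
    ∃ C₁ C₂ c₂ : ℝ, 0 < C₁ ∧ 0 < C₂ ∧ 0 < c₂ ∧
      ∀ δ : ℝ, 0 < δ → δ < 1 →
        (∀ f : ℝ → ℝ, IsClassF M f → ∀ n : ℕ, 1 ≤ n →
          (C₁ * Real.exp (-(1 - δ) * Real.log n)
              ≤ (globalPrior f n).real {θ | ‖θ‖ < tRad δ n} ∧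
            (globalPrior f n).real {θ | ‖θ‖ < tRad δ n}
              ≤ C₂ * Real.exp (-(1 - δ) * Real.log n)) ∧
          ∀ θ₀ : EuclideanSpace ℝ (Fin n), tRad δ n < ‖θ₀‖ →
            priorConc f n θ₀ (tRad δ n)
              ≤ Real.exp (-c₂ * n * Real.log (‖θ₀‖ / tRad δ n))) ∧
        ∀ η : ℝ, 0 < η → ∃ c₁ : ℝ, 0 < c₁ ∧
          ∀ θ₀ : (n : ℕ) → EuclideanSpace ℝ (Fin n),
            (fun n => ‖θ₀ n‖) =o[atTop] (fun n : ℕ => Real.sqrt n) →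
            ∀ᶠ n : ℕ in atTop, ∀ f : ℝ → ℝ, IsClassF M f →
              (1 + η) * tRad δ n ≤ ‖θ₀ n‖ →
              Real.exp (-c₁ * n * Real.log (‖θ₀ n‖ / tRad δ n))
                ≤ priorConc f n (θ₀ n) (tRad δ n) := by
  obtain ⟨C₁, C₂, c₂, hC₁, hC₂, hc₂, small_ball, upper, lower⟩ := mainTheorem1_general hM
  refine ⟨C₁, C₂, c₂, hC₁, hC₂, hc₂, fun δ hδ0 hδ1 =>
    ⟨fun f hf n hn => ⟨?_, upper f hf n _ (tRad_pos hn)⟩, fun η hη => ?_⟩⟩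
  · rw [← priorConc_zero, ← tRad_sq_div δ hn]
    exact small_ball f hf n _ (one_le_tRad hδ0.le hn) (tRad_sq_le hδ1.le hn)
  · obtain ⟨c₁, hc₁, hlower⟩ := lower η hη 1
    refine ⟨c₁, hc₁, fun θ₀ hθ₀ => ?_⟩
    filter_upwards [eventually_norm_sq_le_of_isLittleO_sqrt hθ₀, eventually_ge_atTop 1]
      with n hθ₀n hn f hf
    exact hlower f hf n _ (one_le_tRad hδ0.le hn) (θ₀ n) (by rwa [one_mul])
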